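/- Conventions. Partitions are identified with their Young diagrams. The position of the square in row $i$ and column $j$ is $j-i$; the position of a domino is that of its top-right square. A skew standard tableau (respectively skew standard domino tableau) is a finite chain of partitions in which each step adds one square (respectively one domino). A semistandard tableau of skew shape $\lambda/\mu$ is a filling of $\lambda/\mu$ with natural numbers that is weakly increasing along rows and strictly increasing down columns; a semistandard domino tableau of shape $\lambda/\mu$ is a tiling of $\lambda/\mu$ by dominoes, each carrying a natural number, such that the entries increase weakly along rows and increase strictly down columns when passing from one domino to another. The weight counts, for each $k$, the squares (respectively dominoes) with entry $k$. The standardisation adds the squares (respectively dominoes) by weakly increasing entry, those with equal entries by increasing position. A tableau switching family is a family of partitions $(\lambda^{[i,j]})_{0\le i\le m,\,0\le j\le n}$ such that $\lambda^{[i+1,j]}$ and $\lambda^{[i,j+1]}$ are each obtained from $\lambda^{[i,j]}$ by adding one square, and $\lambda^{[i+1,j]}\ne\lambda^{[i,j+1]}$ whenever the two squares of $\lambda^{[i+1,j+1]}/\lambda^{[i,j]}$ are not adjacent. For standard tableaux, $X(S,T)=(T',S')$ means that there is such a family with left edge ($j=0$) $S$, bottom edge ($i=m$) $T$, top edge ($i=0$)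 $T'$ and right edge ($j=n$) $S'$. For semistandard tableaux, $X(U,V)=(V',U')$ means that this holds for the standardisations, and that $V'$ has the weight of $V$ and $U'$ that of $U$. A self-switching pair is a pair $(U,V)$ of semistandard tableaux of shapes $\nu/\mu$ and $\lambda/\nu$ such that $X(U,V)=(U,V)$ (so that $U$ and $V$ have the same weight, called the weight of the pair); its shape is $\lambda/\mu$. For a semistandard domino tableau $D$ with standardisation $D_0$, write $\pi_1(D)=(U,V)$ if $U$ and $V$ are semistandard tableaux of the same weight as $D$ whose standardisations are the left and bottom edges, respectively, of a symmetric tableau switching family ($\lambda^{[i,j]}=\lambda^{[j,i]}$) with diagonal $(\lambda^{[i,i]})_i=D_0$. Proposition. For each semistandard domino tableau $D$ there is exactly one pair $(U,V)$ with $\pi_1(D)=(U,V)$, and this pair is self-switching; the resulting map $\pi_1$ from semistandard domino tableaux to self-switching pairs of semistandard tableaux is a bijection, and it preserves shape and weight. -/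

import Mathlib

namespace DominoSwitching

/-- The position of a square `(row, column)`: the index `column - row` of its diagonal. -/
def pos (s : ℕ × ℕ) : ℤ := (s.2 : ℤ) - (s.1 : ℤ)

/-! ### Dominoes -/

/-- A domino, given by its inward (top-left) square `(row, col)` and its orientation. -/
@[ext]
structure Domino where
  row : ℕ
  col : ℕ
  vertical : Bool
  deriving DecidableEq

/-- The outward (bottom or right) square of a domino. -/
def Domino.outward (d : Domino) : ℕ × ℕ :=
  if d.vertical then (d.row + 1, d.col) else (d.row, d.col + 1)

/-- The two squares of a domino. -/
def Domino.cells (d : Domino) : Finset (ℕ × ℕ) := {(d.row, d.col), d.outward}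

/-- The position of a domino: the position of its top-right square.  (Only the order of positions
matters, so that using the bottom-left square instead would make no difference.) -/
def Domino.pos (d : Domino) : ℤ :=
  if d.vertical then DominoSwitching.pos (d.row, d.col) else DominoSwitching.pos d.outward

/-! ### Standard tableaux, as chains of partitions -/

/-- `ν` is obtained from `μ` by adding one square. -/
def AddsSquare (μ ν : YoungDiagram) : Prop :=
  ∃ s : ℕ × ℕ, s ∉ μ.cells ∧ ν.cells = insert s μ.cells

/-- `ν` is obtained from `μ` by adding one domino. -/
def AddsDomino (μ ν : YoungDiagram) : Prop :=
  ∃ d : Domino, Disjoint μ.cells d.cells ∧ ν.cells = μ.cells ∪ d.cells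

/-- A skew standard tableau with `n` squares, as a chain of partitions. -/
@[ext]
structure StandardTableau (n : ℕ) where
  part : Fin (n + 1) → YoungDiagram
  step : ∀ i : Fin n, AddsSquare (part i.castSucc) (part i.succ)

/-- A skew standard domino tableau with `n` dominoes, as a chain of partitions. -/
@[ext]
structure StandardDominoTableau (n : ℕ) where
  part : Fin (n + 1) → YoungDiagram
  step : ∀ i : Fin n, AddsDomino (part i.castSucc) (part i.succ)

/-! ### Tableau switching families -/

/-- A tableau switching family of partitions: neighbours differ by one square, and the two
intermediate partitions `part (i+1) j` and `part i (j+1)` are different whenever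
`part (i+1) (j+1)` is not obtained from `part i j` by adding a domino, i.e. whenever the
two squares added are not adjacent. -/
@[ext]
structure SwitchingFamily (m n : ℕ) where
  part : Fin (m + 1) → Fin (n + 1) → YoungDiagram
  step_col : ∀ (i : Fin m) (j : Fin (n + 1)), AddsSquare (part i.castSucc j) (part i.succ j)
  step_row : ∀ (i : Fin (m + 1)) (j : Fin n), AddsSquare (part i j.castSucc) (part i j.succ)
  switch : ∀ (i : Fin m) (j : Fin n),
    ¬ AddsDomino (part i.castSucc j.castSucc) (part i.succ j.succ) →
      part i.succ j.castSucc ≠ part i.castSucc j.succ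

namespace SwitchingFamily

variable {m n : ℕ} (F : SwitchingFamily m n)

/-- The tableau along the column with index `j`. -/
def colTableau (j : Fin (n + 1)) : StandardTableau m :=
  ⟨fun i => F.part i j, fun i => F.step_col i j⟩

/-- The tableau along the row with index `i`. -/
def rowTableau (i : Fin (m + 1)) : StandardTableau n :=
  ⟨fun j => F.part i j, fun j => F.step_row i j⟩

/-- The left edge. -/
def left : StandardTableau m := F.colTableau 0
/-- The right edge. -/
def right : StandardTableau m := F.colTableau (Fin.last n)
/-- The top edge. -/
def top : StandardTableau n := F.rowTableau 0
/-- The bottom edge. -/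
def bottom : StandardTableau n := F.rowTableau (Fin.last m)

end SwitchingFamily

/-- Tableau switching of standard tableaux, `X(S, T) = (T', S')`: some tableau switching family
has `S` as left edge, `T` as bottom edge, `T'` as top edge and `S'` as right edge. -/
def StandardSwitch {m n : ℕ} (S : StandardTableau m) (T : StandardTableau n)
    (T' : StandardTableau n) (S' : StandardTableau m) : Prop :=
  ∃ F : SwitchingFamily m n, F.left = S ∧ F.bottom = T ∧ F.top = T' ∧ F.right = S'

/-- The correspondence `π₀(D) = (S, T)`: there is a symmetric tableau switching family with
diagonal `D`, left edge `S` and bottom edge `T`. -/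
def IsPi0 {n : ℕ} (D : StandardDominoTableau n) (S T : StandardTableau n) : Prop :=
  ∃ F : SwitchingFamily n n, (∀ i j, F.part i j = F.part j i) ∧
    (∀ i, F.part i i = D.part i) ∧ F.left = S ∧ F.bottom = T

/-! ### Semistandard tableaux -/

/-- A semistandard skew tableau of shape `outer / inner`.  Entries are natural numbers, weakly
increasing along rows and strictly increasing down columns; `entry` vanishes outside
the skew diagram, so that a tableau is determined by its shape and its actual entries. -/
@[ext]
structure SemistandardTableau where
  inner : YoungDiagram
  outer : YoungDiagram
  le : inner ≤ outer
  entry : ℕ × ℕ → ℕ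
  row_weak : ∀ i j j' : ℕ, j < j' → (i, j) ∈ outer.cells \ inner.cells →
    (i, j') ∈ outer.cells \ inner.cells → entry (i, j) ≤ entry (i, j')
  col_strict : ∀ i i' j : ℕ, i < i' → (i, j) ∈ outer.cells \ inner.cells →
    (i', j) ∈ outer.cells \ inner.cells → entry (i, j) < entry (i', j)
  zeros : ∀ s, s ∉ outer.cells \ inner.cells → entry s = 0

namespace SemistandardTableau

/-- The weight: the number of occurrences of each entry. -/
def wt (T : SemistandardTableau) (k : ℕ) : ℕ :=
  ((T.outer.cells \ T.inner.cells).filter fun s => T.entry s = k).card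

/-- `S` is the standardisation of `T`: it adds the squares of `T` by weakly increasing entries,
squares with equal entries being added by increasing position (from left to right). -/
def IsStandardisation (T : SemistandardTableau) {n : ℕ} (S : StandardTableau n) : Prop :=
  S.part 0 = T.inner ∧ S.part (Fin.last n) = T.outer ∧
    ∀ i j : Fin n, i < j →
      ∀ s ∈ (S.part i.succ).cells \ (S.part i.castSucc).cells,
      ∀ t ∈ (S.part j.succ).cells \ (S.part j.castSucc).cells,
        T.entry s < T.entry t ∨ (T.entry s = T.entry t ∧ pos s < pos t)

/-- Tableau switching of semistandard tableaux, `X(U, V) = (V', U')`: it is tableau switching of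
the standardisations, the weights being preserved. -/
def Switch (U V V' U' : SemistandardTableau) : Prop :=
  V'.wt = V.wt ∧ U'.wt = U.wt ∧
    ∃ (m n : ℕ) (S : StandardTableau m) (T : StandardTableau n)
      (T' : StandardTableau n) (S' : StandardTableau m),
      U.IsStandardisation S ∧ V.IsStandardisation T ∧
      V'.IsStandardisation T' ∧ U'.IsStandardisation S' ∧ StandardSwitch S T T' S'

end SemistandardTableau

/-- A self-switching pair `(U, V)` of semistandard tableaux: `U` and `V` can be joined to `U|V`,
and `X(U, V) = (U, V)`. -/
@[ext]
structure SelfSwitchingPair where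
  fst : SemistandardTableau
  snd : SemistandardTableau
  join : fst.outer = snd.inner
  selfSwitching : SemistandardTableau.Switch fst snd fst snd

/-! ### Semistandard domino tableaux -/

/-- A semistandard (skew) domino tableau of shape `outer / inner`: a tiling of the skew diagram by
dominoes, each with a natural number as entry, such that entries increase weakly along rows
and increase strictly down columns when passing from one domino to another. -/
@[ext]
structure SemistandardDominoTableau where
  inner : YoungDiagram
  outer : YoungDiagram
  le : inner ≤ outer
  tiles : Finset Domino
  disjoint : ∀ d ∈ tiles, ∀ d' ∈ tiles, d ≠ d' → Disjoint d.cells d'.cells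
  cover : tiles.biUnion Domino.cells = outer.cells \ inner.cells
  entry : Domino → ℕ
  row_weak : ∀ d ∈ tiles, ∀ d' ∈ tiles, ∀ i j j' : ℕ, j < j' →
    (i, j) ∈ d.cells → (i, j') ∈ d'.cells → entry d ≤ entry d'
  col_strict : ∀ d ∈ tiles, ∀ d' ∈ tiles, d ≠ d' → ∀ i i' j : ℕ, i < i' →
    (i, j) ∈ d.cells → (i', j) ∈ d'.cells → entry d < entry d'
  zeros : ∀ d, d ∉ tiles → entry d = 0

namespace SemistandardDominoTableau

/-- The weight: the number of dominoes with each given entry. -/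
def wt (D : SemistandardDominoTableau) (k : ℕ) : ℕ :=
  (D.tiles.filter fun d => D.entry d = k).card

/-- `D₀` is the standardisation of `D`: it adds the dominoes of `D` by weakly increasing entries,
dominoes with equal entries being added by increasing position. -/
def IsStandardisation (D : SemistandardDominoTableau) {n : ℕ}
    (D₀ : StandardDominoTableau n) : Prop :=
  D₀.part 0 = D.inner ∧ D₀.part (Fin.last n) = D.outer ∧
    ∃ tile : Fin n → Domino,
      (∀ i, tile i ∈ D.tiles ∧
        (D₀.part i.succ).cells \ (D₀.part i.castSucc).cells = (tile i).cells) ∧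
      ∀ i j : Fin n, i < j →
        D.entry (tile i) < D.entry (tile j) ∨
          (D.entry (tile i) = D.entry (tile j) ∧ (tile i).pos < (tile j).pos)

/-- The correspondence `π₁(D) = (U, V)`: the semistandard tableaux `U` and `V` have the same
weight as `D`, and their standardisations form the pair `π₀(D₀)`, where `D₀` is the
standardisation of `D`. -/
def IsPi1 (D : SemistandardDominoTableau) (U V : SemistandardTableau) : Prop :=
  U.wt = D.wt ∧ V.wt = D.wt ∧
    ∃ (n : ℕ) (D₀ : StandardDominoTableau n) (S T : StandardTableau n),
      D.IsStandardisation D₀ ∧ U.IsStandardisation S ∧ V.IsStandardisation T ∧ IsPi0 D₀ S T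

end SemistandardDominoTableau

end DominoSwitching

namespace DominoSwitching

/-! The standard case is a matter of symmetry. In a symmetric switching family the two intermediate
partitions of a diagonal small square coincide, so the diagonal adds dominoes
(`addsDomino_diagonal`). Conversely a domino has only one middle partition, and a small square is
determined by three corners when the missing one is an intermediate partition (`exists_switch`,
`switch_unique`); hence a domino chain spreads out from the diagonal to a unique symmetric family
(`exists_symmetric`, `eq_of_diagonal`). A family is also determined by its left and bottom edges
(`eq_of_left_of_bottom`), so comparison with the transpose shows that a family is symmetric exactly
when its top equals its left edge and its right equals its bottom edge (`symmetric_of_self`,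
`top_eq_left`, `right_eq_bottom`).

A semistandard tableau amounts to its standardisation together with a weakly increasing sequence of
entries, in which consecutive entries may agree only where the position ascends; the weight
determines this sequence. It therefore suffices that the domino chain and both edges have the same
ascents. Switching past one square preserves ascents (`ascent_switch`), so all rows share them, and
a row crossing the diagonal links them to the domino chain (`sameAscents_diagonal`). It remains to
sort the tiles of a domino tableau into a chain of partitions (`exists_isStandardisation`). -/

/-- `ν` is obtained from `μ` by adding the square `s`. -/
def Adds (μ : YoungDiagram) (s : ℕ × ℕ) (ν : YoungDiagram) : Prop :=
  s ∉ μ.cells ∧ ν.cells = insert s μ.cells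

/-- The square `t` is the right or lower neighbour of `s`. -/
def Adjacent (s t : ℕ × ℕ) : Prop := t = (s.1 + 1, s.2) ∨ t = (s.1, s.2 + 1)

lemma lowerCells (μ : YoungDiagram) {s t : ℕ × ℕ} (h : s ≤ t) (ht : t ∈ μ.cells) :
    s ∈ μ.cells := μ.isLowerSet h ht

/-! ### Diagonals of squares added in succession -/

namespace Adds

variable {μ ν ν' ρ σ : YoungDiagram} {s t u s' t' : ℕ × ℕ}

lemma mem_iff (h : Adds μ s ν) (x : ℕ × ℕ) : x ∈ ν.cells ↔ x = s ∨ x ∈ μ.cells := by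
  rw [h.2, Finset.mem_insert]

lemma mem_of_le (h : Adds μ s ν) {x : ℕ × ℕ} (hx : x ≤ s) (hne : x ≠ s) : x ∈ μ.cells :=
  ((h.mem_iff x).1 (lowerCells ν hx ((h.mem_iff s).2 (Or.inl rfl)))).resolve_left hne

lemma notMem_of_ge (h : Adds μ s ν) {x : ℕ × ℕ} (hx : s ≤ x) : x ∉ μ.cells :=
  fun hm => h.1 (lowerCells μ hx hm)

lemma right_unique (h : Adds μ s ν) (h' : Adds μ s ν') : ν = ν' :=
  YoungDiagram.ext (h.2.trans h'.2.symm)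

lemma square_unique (h : Adds μ s ν) (h' : Adds μ t ν) : s = t :=
  ((h'.mem_iff s).1 ((h.mem_iff s).2 (Or.inl rfl))).resolve_right h.1

lemma le_or_le_of_pos_eq {s t : ℕ × ℕ} (h : pos s = pos t) : s ≤ t ∨ t ≤ s := by
  simp only [pos] at h
  rcases le_total s.1 t.1 with h1 | h1
  · exact Or.inl ⟨h1, by omega⟩
  · exact Or.inr ⟨h1, by omega⟩

/-- Squares on one diagonal are comparable, and of two comparable squares the smaller must be
present before the larger can be added. -/
lemma pos_ne_of_addable (h : Adds μ s ν) (h' : Adds μ t ν') (hne : s ≠ t) : pos s ≠ pos t := by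
  intro he
  rcases le_or_le_of_pos_eq he with hl | hl
  · exact h.1 (h'.mem_of_le hl hne)
  · exact h'.1 (h.mem_of_le hl hne.symm)

lemma not_le (h : Adds μ s ν) (h' : Adds ν t ρ) : ¬ t ≤ s :=
  fun hl => h'.1 (lowerCells ν hl ((h.mem_iff s).2 (Or.inl rfl)))

/-- On a common diagonal, the square in the row of `s` and the column of `t` would lie strictly
between them. It would have to be present before `t`, but only `s` was added. -/
lemma pos_ne (h : Adds μ s ν) (h' : Adds ν t ρ) : pos s ≠ pos t := by
  intro he
  have hl := (le_or_le_of_pos_eq he).resolve_right (h.not_le h')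
  have hne : s ≠ t := fun e => h.not_le h' e.ge
  obtain ⟨i, j⟩ := s
  obtain ⟨k, l⟩ := t
  simp only [pos, ne_eq, Prod.mk.injEq, Prod.mk_le_mk] at *
  have h1 : (i, l) ∈ ν.cells := h'.mem_of_le ⟨hl.1, le_rfl⟩ (by simp; omega)
  have h2 := ((h.mem_iff _).1 h1).resolve_left (by simp; omega)
  exact h.notMem_of_ge (x := (i, l)) ⟨le_rfl, hl.2⟩ h2

/-- On a common diagonal, both the right and the lower neighbour of `s` would have to be added
before `u`, whereas only `t` is added in between. -/
lemma pos_ne_third (h : Adds μ s ν) (h' : Adds ν t ρ) (h'' : Adds ρ u σ) : pos s ≠ pos u := by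
  intro he
  have hnle : ¬ u ≤ s := fun hl => h''.1 (lowerCells ρ hl
    ((h'.mem_iff s).2 (Or.inr ((h.mem_iff s).2 (Or.inl rfl)))))
  have hl := (le_or_le_of_pos_eq he).resolve_right hnle
  obtain ⟨i, j⟩ := s
  obtain ⟨k, l⟩ := u
  simp only [pos, Prod.mk_le_mk] at *
  have key : ∀ x : ℕ × ℕ, (i, j) ≤ x → x ≠ (i, j) → x ≤ (k, l) → x ≠ (k, l) → x = t := by
    intro x h1 h2 h3 h4
    have h5 := h''.mem_of_le h3 h4
    rw [h'.mem_iff, h.mem_iff] at h5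
    exact h5.resolve_right (not_or.2 ⟨h2, h.notMem_of_ge h1⟩)
  have h1 := key (i + 1, j) (by simp) (by simp) (by simp; omega) (by simp; omega)
  have h2 := key (i, j + 1) (by simp) (by simp) (by simp; omega) (by simp; omega)
  have h3 := h1.trans h2.symm
  simp at h3

lemma adjacent_of_le (h : Adds μ s ν) (h' : Adds ν t ρ) (hl : s ≤ t) : Adjacent s t := by
  have hne : s ≠ t := fun e => h.not_le h' e.ge
  have key : ∀ x : ℕ × ℕ, s ≤ x → x ≠ s → x ≤ t → x = t := by
    intro x h1 h2 h3
    by_contra h4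
    have h5 := h'.mem_of_le h3 h4
    rw [h.mem_iff] at h5
    exact h5.elim h2 (h.notMem_of_ge h1)
  obtain ⟨i, j⟩ := s
  obtain ⟨k, l⟩ := t
  simp only [Prod.mk_le_mk, ne_eq, Prod.mk.injEq, Adjacent] at *
  by_cases hik : i < k
  · left
    have := key (i + 1, j) (by simp) (by simp) (by simp; omega)
    simp at this; omega
  · right
    have := key (i, j + 1) (by simp) (by simp) (by simp; omega)
    simp at this; omega

lemma addsDomino_iff (h : Adds μ s ν) (h' : Adds ν t ρ) : AddsDomino μ ρ ↔ Adjacent s t := by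
  constructor
  · rintro ⟨d, hd, hd'⟩
    have hmem : ∀ x, x ∈ d.cells ↔ x = t ∨ x = s := by
      intro x
      have h1 : x ∈ ρ.cells ↔ x ∈ μ.cells ∨ x ∈ d.cells := by rw [hd', Finset.mem_union]
      rw [h'.mem_iff, h.mem_iff] at h1
      constructor
      · intro hx
        have := Finset.disjoint_right.1 hd hx
        tauto
      · rintro (rfl | rfl)
        · have : x ∉ μ.cells := fun hm => h'.1 ((h.mem_iff x).2 (Or.inr hm))
          tauto
        · have := h.1
          tauto
    refine h.adjacent_of_le h' ?_
    have hnle := h.not_le h'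
    have hs := (hmem s).2 (Or.inr rfl)
    have ht := (hmem t).2 (Or.inl rfl)
    have hle : (d.row, d.col) ≤ d.outward := by
      unfold Domino.outward
      split_ifs <;> simp
    simp only [Domino.cells, Finset.mem_insert, Finset.mem_singleton] at hs ht
    rcases hs with hs | hs <;> rcases ht with ht | ht
    · rw [hs, ht]
    · rw [hs, ht]; exact hle
    · exact absurd (hs ▸ ht ▸ hle) hnle
    · rw [hs, ht]
  · intro hadj
    refine ⟨⟨s.1, s.2, decide (t = (s.1 + 1, s.2))⟩, ?_⟩
    have hc : Domino.cells ⟨s.1, s.2, decide (t = (s.1 + 1, s.2))⟩ = {s, t} := by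
      rcases hadj with rfl | rfl <;> simp [Domino.cells, Domino.outward]
    rw [hc]
    constructor
    · rw [Finset.disjoint_right]
      intro x hx hm
      simp only [Finset.mem_insert, Finset.mem_singleton] at hx
      rcases hx with rfl | rfl
      · exact h.1 hm
      · exact h'.1 ((h.mem_iff _).2 (Or.inr hm))
    · ext x
      simp only [h'.mem_iff, h.mem_iff, Finset.mem_union, Finset.mem_insert, Finset.mem_singleton]
      tauto

/-- Two given squares can be added in at most two orders. -/
lemma eq_or_swap (h : Adds μ s ν) (h' : Adds ν t ρ) (k : Adds μ s' ν') (k' : Adds ν' t' ρ) :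
    (s' = s ∧ t' = t ∧ ν' = ν) ∨ (s' = t ∧ t' = s) := by
  have h1 := (h'.mem_iff s').1 ((k'.mem_iff s').2 (Or.inr ((k.mem_iff s').2 (Or.inl rfl))))
  have h2 := (h'.mem_iff t').1 ((k'.mem_iff t').2 (Or.inl rfl))
  have h3 : t' ≠ s' := fun e => k'.1 ((k.mem_iff t').2 (Or.inl e))
  have h4 : t' ∉ μ.cells := fun hm => k'.1 ((k.mem_iff t').2 (Or.inr hm))
  have h5 := k.1
  rw [h.mem_iff] at h1 h2
  by_cases h6 : s' = s
  · subst h6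
    exact Or.inl ⟨rfl, by tauto, k.right_unique h⟩
  · right
    have h7 : s' = t := by tauto
    exact ⟨h7, by rw [h7] at h3; tauto⟩

end Adds

/-! ### Small squares of a switching family -/

/-- The possible shapes of a small square of a switching family. -/
lemma switch_cases {a₀ a₁ b₀ b₁ : YoungDiagram} {s t v w : ℕ × ℕ}
    (hs : Adds a₀ s a₁) (hw : Adds a₁ w b₁) (hv : Adds a₀ v b₀) (ht : Adds b₀ t b₁)
    (hsw : ¬ AddsDomino a₀ b₁ → b₀ ≠ a₁) :
    (t = s ∧ v = w) ∨ (v = s ∧ t = w ∧ Adjacent s t) := by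
  rcases hs.eq_or_swap hw hv ht with ⟨h1, h2, h3⟩ | ⟨h1, h2⟩
  · right
    refine ⟨h1, h2, ?_⟩
    have := not_imp_not.1 hsw h3
    rw [h2]
    exact (hs.addsDomino_iff hw).1 this
  · exact Or.inl ⟨h2, h1⟩

/-- If the two squares do not form a domino they are incomparable, so they can be added in the other
order; for a domino the same order is kept. -/
lemma exists_switch {μ ν ρ : YoungDiagram} (h : AddsSquare μ ν) (h' : AddsSquare ν ρ) :
    ∃ ν', AddsSquare μ ν' ∧ AddsSquare ν' ρ ∧ (¬ AddsDomino μ ρ → ν' ≠ ν) := by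
  obtain ⟨s, hs⟩ := id h
  obtain ⟨t, ht⟩ := id h'
  change Adds μ s ν at hs
  change Adds ν t ρ at ht
  by_cases hd : AddsDomino μ ρ
  · exact ⟨ν, h, h', fun hn => absurd hd hn⟩
  have hnle : ¬ s ≤ t := fun hl => hd ((hs.addsDomino_iff ht).2 (hs.adjacent_of_le ht hl))
  have hlow : IsLowerSet ((insert t μ.cells : Finset (ℕ × ℕ)) : Set (ℕ × ℕ)) := by
    intro x y hyx hx
    simp only [Finset.coe_insert, Set.mem_insert_iff, Finset.mem_coe] at hx ⊢
    rcases hx with rfl | hx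
    · by_cases hy : y = x
      · exact Or.inl hy
      · have := (hs.mem_iff y).1 (ht.mem_of_le hyx hy)
        rcases this with rfl | h
        · exact absurd hyx hnle
        · exact Or.inr h
    · exact Or.inr (lowerCells μ hyx hx)
  have htμ : t ∉ μ.cells := fun hm => ht.1 ((hs.mem_iff _).2 (Or.inr hm))
  have hst : s ≠ t := fun e => hnle e.le
  refine ⟨⟨insert t μ.cells, hlow⟩, ⟨t, htμ, rfl⟩, ⟨s, ?_, ?_⟩, ?_⟩
  · simp only [Finset.mem_insert]
    exact not_or.2 ⟨hst, hs.1⟩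
  · rw [ht.2, hs.2, Finset.insert_comm]
  · rintro _ rfl
    exact ht.1 (Finset.mem_insert_self _ _)

/-- Each candidate either keeps or swaps the order. Keeping it is allowed only for a domino, and for
a domino the swap is impossible because the inward square must come first. -/
lemma switch_unique {μ ν ρ ν₁ ν₂ : YoungDiagram} (h : AddsSquare μ ν) (h' : AddsSquare ν ρ)
    (h₁ : AddsSquare μ ν₁) (h₁' : AddsSquare ν₁ ρ) (hs₁ : ¬ AddsDomino μ ρ → ν₁ ≠ ν)
    (h₂ : AddsSquare μ ν₂) (h₂' : AddsSquare ν₂ ρ) (hs₂ : ¬ AddsDomino μ ρ → ν₂ ≠ ν) :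
    ν₁ = ν₂ := by
  obtain ⟨s, hs⟩ := h
  obtain ⟨t, ht⟩ := h'
  obtain ⟨s₁, k₁⟩ := h₁
  obtain ⟨t₁, l₁⟩ := h₁'
  obtain ⟨s₂, k₂⟩ := h₂
  obtain ⟨t₂, l₂⟩ := h₂'
  change Adds _ _ _ at hs ht k₁ l₁ k₂ l₂
  have aux : ∀ {s₁ t₁ : ℕ × ℕ} {ν₁ : YoungDiagram}, Adds μ s₁ ν₁ → Adds ν₁ t₁ ρ →
      s₁ = t → Adjacent s t → False := by
    rintro s₁ t₁ ν₁ k₁ l₁ rfl hadj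
    refine hs.1 (k₁.mem_of_le ?_ fun e => hs.not_le ht e.ge)
    rcases hadj with rfl | rfl <;> simp [Prod.le_def]
  rcases hs.eq_or_swap ht k₁ l₁ with ⟨-, -, rfl⟩ | ⟨e₁, -⟩ <;>
    rcases hs.eq_or_swap ht k₂ l₂ with ⟨-, -, rfl⟩ | ⟨e₂, -⟩
  · rfl
  · exact (aux k₂ l₂ e₂ ((hs.addsDomino_iff ht).1 (not_imp_not.1 hs₁ rfl))).elim
  · exact (aux k₁ l₁ e₁ ((hs.addsDomino_iff ht).1 (not_imp_not.1 hs₂ rfl))).elim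
  · exact (e₁ ▸ k₁).right_unique (e₂ ▸ k₂)

lemma Adjacent.pos_eq {s t : ℕ × ℕ} (h : Adjacent s t) : pos t = pos s - 1 ∨ pos t = pos s + 1 := by
  rcases h with rfl | rfl
  · left; simp [pos]; ring
  · right; simp [pos]; ring

/-- Switching past one square preserves descents. -/
lemma ascent_switch {a₀ a₁ a₂ b₀ b₁ b₂ : YoungDiagram} {s₁ s₂ t₁ t₂ : ℕ × ℕ}
    (hs₁ : Adds a₀ s₁ a₁) (hs₂ : Adds a₁ s₂ a₂) (ht₁ : Adds b₀ t₁ b₁) (ht₂ : Adds b₁ t₂ b₂)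
    (h₀ : AddsSquare a₀ b₀) (h₁ : AddsSquare a₁ b₁) (h₂ : AddsSquare a₂ b₂)
    (hsw₁ : ¬ AddsDomino a₀ b₁ → b₀ ≠ a₁) (hsw₂ : ¬ AddsDomino a₁ b₂ → b₁ ≠ a₂) :
    pos s₁ < pos s₂ ↔ pos t₁ < pos t₂ := by
  obtain ⟨v₀, hv₀⟩ := h₀
  obtain ⟨v₁, hv₁⟩ := h₁
  obtain ⟨v₂, hv₂⟩ := h₂
  change Adds _ _ _ at hv₀ hv₁ hv₂
  have hs := hs₁.pos_ne hs₂
  have ht := ht₁.pos_ne ht₂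
  -- Each of the two squares either stays put or moves to a neighbouring diagonal. If one stays and
  -- the other moves by one diagonal, their order cannot change, since they share a diagonal neither
  -- before nor after. If both move, then `t₁ = s₂`, and the two unit steps from `s₁` to `s₂` to
  -- `t₂` go the same way because `s₁` and `t₂` are on different diagonals.
  rcases switch_cases hs₁ hv₁ hv₀ ht₁ hsw₁ with ⟨e₁, e₂⟩ | ⟨e₁, e₂, hadj⟩ <;>
    rcases switch_cases hs₂ hv₂ hv₁ ht₂ hsw₂ with ⟨e₃, e₄⟩ | ⟨e₃, e₄, hadj'⟩
  · rw [e₁, e₃]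
  · have := hadj'.pos_eq
    rw [e₁] at ht ⊢
    omega
  · have hne : s₂ ≠ v₁ := by
      rintro rfl
      exact hv₂.1 ((hs₂.mem_iff _).2 (Or.inl e₄.symm))
    have h3 := hs₂.pos_ne_of_addable hv₁ hne
    have := hadj.pos_eq
    rw [e₃] at ht ⊢
    rw [e₂] at *
    omega
  · subst e₂ e₃ e₄
    have := hs₁.pos_ne_third hs₂ hv₂
    have := hadj.pos_eq
    have := hadj'.pos_eq
    omega

/-! ### Splitting a domino into two squares -/

lemma exists_middle {μ ρ : YoungDiagram} (h : AddsDomino μ ρ) :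
    ∃ ν, AddsSquare μ ν ∧ AddsSquare ν ρ := by
  obtain ⟨d, hd, hd'⟩ := h
  have hin : (d.row, d.col) ∉ μ.cells :=
    Finset.disjoint_right.1 hd (by simp [Domino.cells])
  have hout : d.outward ∉ μ.cells := Finset.disjoint_right.1 hd (by simp [Domino.cells])
  have hnle : ¬ d.outward ≤ (d.row, d.col) := by
    unfold Domino.outward
    split_ifs <;> simp
  have hmem : ∀ x, x ∈ ρ.cells ↔ x ∈ μ.cells ∨ x = (d.row, d.col) ∨ x = d.outward := by
    intro x
    rw [hd', Finset.mem_union]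
    simp [Domino.cells]
  have hlow : IsLowerSet ((insert (d.row, d.col) μ.cells : Finset (ℕ × ℕ)) : Set (ℕ × ℕ)) := by
    intro x y hyx hx
    simp only [Finset.coe_insert, Set.mem_insert_iff, Finset.mem_coe] at hx ⊢
    rcases hx with rfl | hx
    · have := (hmem y).1 (lowerCells ρ hyx ((hmem _).2 (Or.inr (Or.inl rfl))))
      rcases this with h | h | rfl
      · exact Or.inr h
      · exact Or.inl h
      · exact absurd hyx hnle
    · exact Or.inr (lowerCells μ hyx hx)
  refine ⟨⟨insert (d.row, d.col) μ.cells, hlow⟩, ⟨_, hin, rfl⟩, ⟨d.outward, ?_, ?_⟩⟩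
  · simp only [Finset.mem_insert]
    exact not_or.2 ⟨fun e => hnle e.le, hout⟩
  · ext x
    rw [hmem]
    simp only [Finset.mem_insert]
    tauto

/-- The squares of an added domino are added in the order inward, outward. -/
lemma adds_of_domino {μ ν ρ : YoungDiagram} {d : Domino}
    (hd' : ρ.cells \ μ.cells = d.cells) (h : AddsSquare μ ν) (h' : AddsSquare ν ρ) :
    Adds μ (d.row, d.col) ν ∧ Adds ν d.outward ρ := by
  obtain ⟨s, hs⟩ := h
  obtain ⟨t, ht⟩ := h'
  change Adds _ _ _ at hs ht
  have hmem : ∀ x, (x = s ∨ x = t) ↔ (x = (d.row, d.col) ∨ x = d.outward) := by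
    intro x
    have h1 : x ∈ ρ.cells \ μ.cells ↔ x ∈ d.cells := by rw [hd']
    have h2 : x ∈ d.cells ↔ (x = (d.row, d.col) ∨ x = d.outward) := by simp [Domino.cells]
    rw [← h2, ← h1, Finset.mem_sdiff, ht.mem_iff, hs.mem_iff]
    have h3 := hs.1
    have h4 : t ∉ μ.cells := fun hm => ht.1 ((hs.mem_iff t).2 (Or.inr hm))
    constructor
    · rintro (rfl | rfl) <;> tauto
    · tauto
  have hle : (d.row, d.col) ≤ d.outward := by
    unfold Domino.outward
    split_ifs <;> simp
  have hne : d.outward ≠ (d.row, d.col) := by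
    unfold Domino.outward
    split_ifs <;> simp
  have hnle := hs.not_le ht
  by_cases hst : s = (d.row, d.col)
  · have : t = d.outward := by
      have h1 := (hmem t).1 (Or.inr rfl)
      have h2 : t ≠ s := fun e => hnle e.le
      rw [hst] at h2
      tauto
    rw [← this, ← hst]
    exact ⟨hs, ht⟩
  · exfalso
    have h1 := ((hmem s).1 (Or.inl rfl)).resolve_left hst
    have h2 : t = (d.row, d.col) := (((hmem (d.row, d.col)).2 (Or.inl rfl)).resolve_left
      (fun e => hst e.symm)).symm
    exact hnle (h1 ▸ h2 ▸ hle)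

/-- The inward square of `e` avoids both of the consecutive diagonals met by `d`, so it lies
entirely on one side of `d`, and the outward square of `e` is too close to reverse the comparison.
-/
lemma pos_domino_lt_iff {κ κ' μ ν' ρ : YoungDiagram} {d e : Domino}
    (h₁ : Adds κ (d.row, d.col) κ') (h₂ : Adds κ' d.outward μ)
    (h₃ : Adds μ (e.row, e.col) ν') (h₄ : Adds ν' e.outward ρ) :
    d.pos < e.pos ↔ pos d.outward < pos (e.row, e.col) := by
  have := h₂.pos_ne h₃
  have := h₁.pos_ne_third h₂ h₃
  obtain ⟨i, j, _ | _⟩ := d <;> obtain ⟨k, l, _ | _⟩ := e <;>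
    simp [Domino.pos, Domino.outward, pos] at * <;> omega

/-! ### Existence of symmetric families -/

open Classical in
/-- The other partition of a switching square. -/
noncomputable def switchPart (μ ν ρ : YoungDiagram) : YoungDiagram :=
  if h : AddsSquare μ ν ∧ AddsSquare ν ρ then (exists_switch h.1 h.2).choose else ν

lemma switchPart_spec {μ ν ρ : YoungDiagram} (h : AddsSquare μ ν) (h' : AddsSquare ν ρ) :
    AddsSquare μ (switchPart μ ν ρ) ∧ AddsSquare (switchPart μ ν ρ) ρ ∧
      (¬ AddsDomino μ ρ → switchPart μ ν ρ ≠ ν) := by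
  unfold switchPart
  rw [dif_pos ⟨h, h'⟩]
  exact (exists_switch h h').choose_spec

open Classical in
/-- The partition obtained from `μ` by adding the inward half of a domino. -/
noncomputable def middlePart (μ ρ : YoungDiagram) : YoungDiagram :=
  if h : AddsDomino μ ρ then (exists_middle h).choose else μ

lemma middlePart_spec {μ ρ : YoungDiagram} (h : AddsDomino μ ρ) :
    AddsSquare μ (middlePart μ ρ) ∧ AddsSquare (middlePart μ ρ) ρ := by
  unfold middlePart
  rw [dif_pos h]
  exact (exists_middle h).choose_spec

/-- The parts at distance `k` from the diagonal of the symmetric family with diagonal `d`. -/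
noncomputable def offDiagonal (d : ℕ → YoungDiagram) : ℕ → ℕ → YoungDiagram
  | 0, j => d j
  | 1, j => middlePart (d j) (d (j + 1))
  -- The index pair `k`, `j` stands for row `j + k` and column `j`; the three arguments are the
  -- other corners of the small square with bottom-left corner in row `j + k + 2` and column `j`.
  | k + 2, j => switchPart (offDiagonal d (k + 1) j) (offDiagonal d k (j + 1))
      (offDiagonal d (k + 1) (j + 1))

lemma offDiagonal_step {d : ℕ → YoungDiagram} {n : ℕ}
    (hd : ∀ j < n, AddsDomino (d j) (d (j + 1))) (k : ℕ) : ∀ j, j + k < n →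
      AddsSquare (offDiagonal d k j) (offDiagonal d (k + 1) j) ∧
      AddsSquare (offDiagonal d (k + 1) j) (offDiagonal d k (j + 1)) := by
  induction k with
  | zero => exact fun j hj => middlePart_spec (hd j hj)
  | succ k ih =>
    intro j hj
    have := switchPart_spec (ih j (by omega)).2 (ih (j + 1) (by omega)).1
    exact ⟨this.1, this.2.1⟩

lemma offDiagonal_switch {d : ℕ → YoungDiagram} {n : ℕ}
    (hd : ∀ j < n, AddsDomino (d j) (d (j + 1))) (k j : ℕ) (hj : j + k + 1 < n) :
    ¬ AddsDomino (offDiagonal d (k + 1) j) (offDiagonal d (k + 1) (j + 1)) →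
      offDiagonal d (k + 2) j ≠ offDiagonal d k (j + 1) :=
  (switchPart_spec (offDiagonal_step hd k j (by omega)).2
    (offDiagonal_step hd k (j + 1) (by omega)).1).2.2

/-- The symmetric array of partitions with diagonal `d`. -/
noncomputable def symmetricPart (d : ℕ → YoungDiagram) (i j : ℕ) : YoungDiagram :=
  if j ≤ i then offDiagonal d (i - j) j else offDiagonal d (j - i) i

lemma symmetricPart_comm (d : ℕ → YoungDiagram) (i j : ℕ) :
    symmetricPart d i j = symmetricPart d j i := by
  unfold symmetricPart
  rcases lt_trichotomy i j with h | rfl | h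
  · rw [if_neg (by omega), if_pos (by omega)]
  · rfl
  · rw [if_pos (by omega), if_neg (by omega)]

lemma symmetricPart_add (d : ℕ → YoungDiagram) {i j k : ℕ} (h : i = j + k) :
    symmetricPart d i j = offDiagonal d k j := by
  subst h
  simp [symmetricPart]

lemma symmetricPart_step {d : ℕ → YoungDiagram} {n : ℕ}
    (hd : ∀ j < n, AddsDomino (d j) (d (j + 1))) (i j : ℕ) (hi : i < n) (hj : j ≤ n) :
    AddsSquare (symmetricPart d i j) (symmetricPart d (i + 1) j) := by
  rcases le_or_gt j i with h | h
  · obtain ⟨k, rfl⟩ := Nat.exists_eq_add_of_le h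
    rw [symmetricPart_add d rfl, symmetricPart_add d (k := k + 1) (by omega)]
    exact (offDiagonal_step hd k j hi).1
  · obtain ⟨k, rfl⟩ := Nat.exists_eq_add_of_le h
    rw [symmetricPart_comm d i, symmetricPart_comm d (i + 1),
      symmetricPart_add d (k := k + 1) (by omega), symmetricPart_add d (k := k) (by omega)]
    exact (offDiagonal_step hd k i (by omega)).2

lemma symmetricPart_switch {d : ℕ → YoungDiagram} {n : ℕ}
    (hd : ∀ j < n, AddsDomino (d j) (d (j + 1))) (i j : ℕ) (hi : i < n) (hj : j < n)
    (hnd : ¬ AddsDomino (symmetricPart d i j) (symmetricPart d (i + 1) (j + 1))) :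
    symmetricPart d (i + 1) j ≠ symmetricPart d i (j + 1) := by
  wlog h : j ≤ i generalizing i j
  · rw [symmetricPart_comm d i, symmetricPart_comm d (i + 1)] at hnd
    rw [symmetricPart_comm d i, symmetricPart_comm d (i + 1)]
    exact (this j i hj hi hnd (by omega)).symm
  rcases h.eq_or_lt with rfl | h
  -- On the diagonal the two partitions do coincide, but the step is a domino, so the condition is
  -- void.
  · rw [symmetricPart_add d (i := j) (k := 0) rfl,
      symmetricPart_add d (i := j + 1) (k := 0) rfl] at hnd
    exact absurd (hd j hj) hnd
  · obtain ⟨k, rfl⟩ := Nat.exists_eq_add_of_le h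
    rw [symmetricPart_add d (k := k + 1) (by omega),
      symmetricPart_add d (k := k + 1) (by omega)] at hnd
    rw [symmetricPart_add d (k := k + 2) (by omega), symmetricPart_add d (k := k) (by omega)]
    exact offDiagonal_switch hd k j (by omega) hnd

namespace SwitchingFamily

theorem exists_symmetric {n : ℕ} (D : StandardDominoTableau n) :
    ∃ F : SwitchingFamily n n, (∀ i j, F.part i j = F.part j i) ∧ ∀ i, F.part i i = D.part i := by
  -- The chain is continued as a constant beyond `n`, so that the recursion can run over `ℕ`.
  let d : ℕ → YoungDiagram := fun k => D.part ⟨min k n, by omega⟩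
  have hd : ∀ j < n, AddsDomino (d j) (d (j + 1)) := by
    intro j hj
    have h := D.step ⟨j, hj⟩
    have e1 : d j = D.part (Fin.castSucc ⟨j, hj⟩) := by
      simp only [d]; congr 1; ext; simp; omega
    have e2 : d (j + 1) = D.part (Fin.succ ⟨j, hj⟩) := by
      simp only [d]; congr 1; ext; simp; omega
    rwa [e1, e2]
  have hcol := symmetricPart_step hd
  refine ⟨⟨fun i j => symmetricPart d i j, fun i j => hcol i j i.2 (by omega), fun i j => ?_,
    fun i j => symmetricPart_switch hd i j i.2 j.2⟩, fun i j => symmetricPart_comm d i j,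
    fun i => ?_⟩
  · rw [symmetricPart_comm d i, symmetricPart_comm d i]
    exact hcol j i j.2 (by omega)
  · change symmetricPart d i i = _
    rw [symmetricPart_add d (i := i) (k := 0) rfl]
    simp only [offDiagonal, d]
    have := i.is_le
    congr 1
    ext
    simp
    omega

/-! ### Uniqueness of families -/

lemma addsDomino_diagonal {n : ℕ} {F : SwitchingFamily n n}
    (hF : ∀ i j, F.part i j = F.part j i) (i : Fin n) :
    AddsDomino (F.part i.castSucc i.castSucc) (F.part i.succ i.succ) :=
  not_imp_not.1 (F.switch i i) (hF _ _)

/-- Columns are filled from left to right and each column from the bottom up; every step finds the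
top-right corner of a small square from its other three. -/
lemma eq_of_left_of_bottom {m n : ℕ} {F F' : SwitchingFamily m n} (hl : F.left = F'.left)
    (hb : F.bottom = F'.bottom) : F = F' := by
  have hl' : ∀ i, F.part i 0 = F'.part i 0 := fun i => congrFun (congrArg StandardTableau.part hl) i
  have hb' : ∀ j, F.part (Fin.last m) j = F'.part (Fin.last m) j :=
    fun j => congrFun (congrArg StandardTableau.part hb) j
  have key : ∀ j i, F.part i j = F'.part i j := by
    intro j
    induction j using Fin.induction with
    | zero => exact hl'
    | succ j ihj =>
      intro i
      induction i using Fin.reverseInduction with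
      | last => exact hb' _
      | cast i ihi =>
        have h1 := F.step_row i.castSucc j
        have h2 := F.step_col i j.succ
        have h3 := F.switch i j
        have h4 := F.step_col i j.castSucc
        have h5 := F.step_row i.succ j
        rw [ihj, ihi] at h3
        rw [ihj] at h1 h3 h4 h5
        rw [ihi] at h2 h5
        rw [ihj] at h4
        exact switch_unique h4 h5 h1 h2 (fun h => (h3 h).symm) (F'.step_row i.castSucc j)
          (F'.step_col i j.succ) (fun h => (F'.switch i j h).symm)
  ext1
  funext i j
  exact key j i

/-- Induction on the distance from the diagonal, using the small square whose other corners are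
nearer to it. -/
lemma eq_of_diagonal {n : ℕ} {F F' : SwitchingFamily n n}
    (hF : ∀ i j, F.part i j = F.part j i) (hF' : ∀ i j, F'.part i j = F'.part j i)
    (hd : ∀ i, F.part i i = F'.part i i) : F = F' := by
  have key : ∀ k, ∀ j i : Fin (n + 1), (i : ℕ) = j + k → F.part i j = F'.part i j := by
    intro k
    induction k using Nat.strong_induction_on with
    | _ k ih =>
      intro j i hij
      match k, ih, hij with
      | 0, _, hij =>
        have : i = j := Fin.ext hij
        rw [this, hd]
      | k + 1, ih, hij =>
        obtain ⟨i, rfl⟩ : ∃ i' : Fin n, i = i'.succ := ⟨⟨i - 1, by omega⟩, by ext; simp; omega⟩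
        obtain ⟨j, rfl⟩ : ∃ j' : Fin n, j = j'.castSucc := ⟨⟨j, by simp at hij; omega⟩, rfl⟩
        simp at hij
        have e1 := ih k (by omega) j.castSucc i.castSucc (by simp; omega)
        have e2 := ih k (by omega) j.succ i.succ (by simp; omega)
        have h1 := F.step_col i j.castSucc
        have h2 := F.step_row i.succ j
        rw [e1] at h1
        rw [e2] at h2
        cases k with
        | zero =>
          have : i = j := Fin.ext (by omega)
          subst this
          have hA := addsDomino_diagonal hF' i
          -- At distance one both switch conditions are void, and uniqueness is that of the middle
          -- partition of a domino.
          exact switch_unique h1 h2 h1 h2 (absurd hA) (F'.step_col i i.castSucc)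
            (F'.step_row i.succ i) (absurd hA)
        | succ k =>
          have e3 := ih k (by omega) j.succ i.castSucc (by simp; omega)
          have h3 := F.switch i j
          rw [e1, e2, e3] at h3
          exact switch_unique (F'.step_row i.castSucc j) (F'.step_col i j.succ) h1 h2 h3
            (F'.step_col i j.castSucc) (F'.step_row i.succ j) (F'.switch i j)
  ext1
  funext i j
  rcases le_total j i with h | h
  · exact key (i - j) j i (by have := Fin.le_def.1 h; omega)
  · rw [hF, hF']
    exact key (j - i) i j (by have := Fin.le_def.1 h; omega)

/-- The transposed family. -/
def transpose {m n : ℕ} (F : SwitchingFamily m n) : SwitchingFamily n m where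
  part i j := F.part j i
  step_col i j := F.step_row j i
  step_row i j := F.step_col j i
  switch i j h := (F.switch j i h).symm

/-- The hypotheses say that the transposed family has the same left and bottom edges. -/
lemma symmetric_of_self {n : ℕ} {F : SwitchingFamily n n} (h₁ : F.top = F.left)
    (h₂ : F.right = F.bottom) (i j : Fin (n + 1)) : F.part i j = F.part j i := by
  have : F.transpose = F := eq_of_left_of_bottom h₁ h₂
  exact congrFun (congrFun (congrArg SwitchingFamily.part this) j) i

lemma top_eq_left {n : ℕ} {F : SwitchingFamily n n} (hF : ∀ i j, F.part i j = F.part j i) :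
    F.top = F.left := by
  ext1
  funext i
  exact hF _ _

lemma right_eq_bottom {n : ℕ} {F : SwitchingFamily n n} (hF : ∀ i j, F.part i j = F.part j i) :
    F.right = F.bottom := by
  ext1
  funext i
  exact hF _ _

end SwitchingFamily

/-! ### Ascents -/

namespace StandardTableau

variable {n : ℕ} (S : StandardTableau n)

/-- The square added at a given step. -/
noncomputable def square (i : Fin n) : ℕ × ℕ := (S.step i).choose

lemma adds_square (i : Fin n) : Adds (S.part i.castSucc) (S.square i) (S.part i.succ) :=
  (S.step i).choose_spec

end StandardTableau

namespace StandardDominoTableau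

variable {n : ℕ} (D : StandardDominoTableau n)

/-- The domino added at a given step. -/
noncomputable def tile (i : Fin n) : Domino := (D.step i).choose

lemma disjoint_tile (i : Fin n) : Disjoint (D.part i.castSucc).cells (D.tile i).cells :=
  (D.step i).choose_spec.1

lemma cells_succ (i : Fin n) :
    (D.part i.succ).cells = (D.part i.castSucc).cells ∪ (D.tile i).cells :=
  (D.step i).choose_spec.2

lemma sdiff_eq (i : Fin n) :
    (D.part i.succ).cells \ (D.part i.castSucc).cells = (D.tile i).cells := by
  rw [cells_succ, Finset.union_sdiff_cancel_left (D.disjoint_tile i)]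

end StandardDominoTableau

/-- Two sequences of integers have the same ascents. -/
def SameAscents {n : ℕ} (f g : Fin n → ℤ) : Prop :=
  ∀ (i : ℕ) (h : i + 1 < n), f ⟨i, by omega⟩ < f ⟨i + 1, h⟩ ↔ g ⟨i, by omega⟩ < g ⟨i + 1, h⟩

lemma strictMono_fin_iff {α : Type*} [Preorder α] {n : ℕ} {f : Fin n → α} :
    StrictMono f ↔ ∀ (i : ℕ) (h : i + 1 < n), f ⟨i, by omega⟩ < f ⟨i + 1, h⟩ := by
  cases n with
  | zero => exact ⟨fun _ i h => by omega, fun _ i => i.elim0⟩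
  | succ n =>
    rw [Fin.strictMono_iff_lt_succ]
    exact ⟨fun h i hi => h ⟨i, by omega⟩, fun h i => h i (by omega)⟩

/-- Strict monotonicity is tested on neighbours, where the second component enters only through its
ascents. -/
lemma SameAscents.strictMono_iff {n : ℕ} {f g : Fin n → ℤ} (h : SameAscents f g)
    (e : Fin n → ℕ) :
    StrictMono (fun i => toLex (e i, f i)) ↔ StrictMono (fun i => toLex (e i, g i)) := by
  rw [strictMono_fin_iff, strictMono_fin_iff]
  refine forall₂_congr fun i hi => ?_
  rw [Prod.Lex.toLex_lt_toLex, Prod.Lex.toLex_lt_toLex]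
  simp only [h i hi]

namespace SwitchingFamily

lemma sameAscents_row {m n : ℕ} (F : SwitchingFamily m n) (i : Fin (m + 1)) :
    SameAscents (fun j => pos ((F.rowTableau 0).square j))
      (fun j => pos ((F.rowTableau i).square j)) := by
  induction i using Fin.induction with
  | zero => exact fun _ _ => Iff.rfl
  | succ i ih =>
    intro j hj
    rw [ih j hj]
    exact ascent_switch ((F.rowTableau i.castSucc).adds_square ⟨j, by omega⟩)
      ((F.rowTableau i.castSucc).adds_square ⟨j + 1, hj⟩)
      ((F.rowTableau i.succ).adds_square ⟨j, by omega⟩)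
      ((F.rowTableau i.succ).adds_square ⟨j + 1, hj⟩)
      (F.step_col i _) (F.step_col i _) (F.step_col i _)
      (F.switch i ⟨j, by omega⟩) (F.switch i ⟨j + 1, hj⟩)

lemma sameAscents_diagonal {n : ℕ} {F : SwitchingFamily n n} {D : StandardDominoTableau n}
    (hD : ∀ i, F.part i i = D.part i) (i : Fin (n + 1)) :
    SameAscents (fun j => (D.tile j).pos) (fun j => pos ((F.rowTableau i).square j)) := by
  intro j hj
  -- All rows have the same ascents, so row `j + 1` may be used: it meets the diagonal between its
  -- steps `j` and `j + 1`, which add the outward half of one domino and the inward half of the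
  -- next.
  rw [← F.sameAscents_row i j hj, F.sameAscents_row ⟨j + 1, by omega⟩ j hj]
  let a : Fin n := ⟨j, by omega⟩
  let b : Fin n := ⟨j + 1, hj⟩
  have ha := D.sdiff_eq a
  have hb := D.sdiff_eq b
  rw [← hD, ← hD] at ha hb
  obtain ⟨h1, h2⟩ := adds_of_domino ha (F.step_col a a.castSucc) (F.step_row a.succ a)
  obtain ⟨h3, h4⟩ := adds_of_domino hb (F.step_row b.castSucc b) (F.step_col b b.succ)
  have h5 := (F.rowTableau a.succ).adds_square a
  have h6 := (F.rowTableau a.succ).adds_square b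
  have e1 := h5.square_unique h2
  have e2 := h6.square_unique h3
  change (D.tile a).pos < (D.tile b).pos ↔ pos ((F.rowTableau a.succ).square a) <
    pos ((F.rowTableau a.succ).square b)
  rw [e1, e2]
  exact pos_domino_lt_iff h1 h2 h3 h4

end SwitchingFamily

/-! ### Chains of partitions, for squares and dominoes alike -/

/-- The partitions `P` form a chain, `P (i + 1)` being obtained from `P i` by adding `c i`. -/
structure IsChainBy {n : ℕ} (P : Fin (n + 1) → YoungDiagram) (c : Fin n → Finset (ℕ × ℕ)) :
    Prop where
  disjoint : ∀ i, Disjoint (P i.castSucc).cells (c i)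
  union : ∀ i, (P i.succ).cells = (P i.castSucc).cells ∪ c i

namespace IsChainBy

variable {n : ℕ} {P P' : Fin (n + 1) → YoungDiagram} {c : Fin n → Finset (ℕ × ℕ)}

lemma mem_iff (h : IsChainBy P c) (x : ℕ × ℕ) (i : Fin (n + 1)) :
    x ∈ (P i).cells ↔ x ∈ (P 0).cells ∨ ∃ k : Fin n, k.castSucc < i ∧ x ∈ c k := by
  induction i using Fin.induction with
  | zero => simp
  | succ i ih =>
    rw [h.union, Finset.mem_union, ih, or_assoc]
    refine or_congr_right ?_
    constructor
    · rintro (⟨k, hk, hx⟩ | hx)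
      · exact ⟨k, hk.trans i.castSucc_lt_succ, hx⟩
      · exact ⟨i, i.castSucc_lt_succ, hx⟩
    · rintro ⟨k, hk, hx⟩
      rcases (Fin.castSucc_lt_succ_iff.1 hk).eq_or_lt with rfl | hlt
      · exact Or.inr hx
      · exact Or.inl ⟨k, Fin.castSucc_lt_castSucc_iff.2 hlt, hx⟩

lemma subset (h : IsChainBy P c) {i j : Fin (n + 1)} (hij : i ≤ j) :
    (P i).cells ⊆ (P j).cells := by
  intro x
  rw [h.mem_iff x i, h.mem_iff x j]
  rintro (hx | ⟨k, hk, hx⟩)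
  · exact Or.inl hx
  · exact Or.inr ⟨k, hk.trans_le hij, hx⟩

lemma notMem (h : IsChainBy P c) {k : Fin n} {i : Fin (n + 1)} (hi : i ≤ k.castSucc)
    {x : ℕ × ℕ} (hx : x ∈ c k) : x ∉ (P i).cells :=
  fun hm => Finset.disjoint_left.1 (h.disjoint k) (h.subset hi hm) hx

lemma mem_succ (h : IsChainBy P c) {k : Fin n} {x : ℕ × ℕ} (hx : x ∈ c k) :
    x ∈ (P k.succ).cells := by
  rw [h.union]
  exact Finset.mem_union_right _ hx

lemma index_le (h : IsChainBy P c) {k l : Fin n} {x y : ℕ × ℕ} (hx : x ∈ c k) (hy : y ∈ c l)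
    (hxy : x ≤ y) : k ≤ l := by
  by_contra! hlt
  exact h.notMem (Fin.succ_le_castSucc_iff.2 hlt) hx (lowerCells _ hxy (h.mem_succ hy))

lemma index_eq (h : IsChainBy P c) {k l : Fin n} {x : ℕ × ℕ} (hx : x ∈ c k) (hy : x ∈ c l) :
    k = l :=
  le_antisymm (h.index_le hx hy le_rfl) (h.index_le hy hx le_rfl)

lemma mem_skew_iff (h : IsChainBy P c) (x : ℕ × ℕ) :
    x ∈ (P (Fin.last n)).cells \ (P 0).cells ↔ ∃ k, x ∈ c k := by
  rw [Finset.mem_sdiff, h.mem_iff x (Fin.last n)]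
  constructor
  · rintro ⟨h1 | ⟨k, -, hx⟩, h2⟩
    · exact absurd h1 h2
    · exact ⟨k, hx⟩
  · rintro ⟨k, hx⟩
    exact ⟨Or.inr ⟨k, Fin.castSucc_lt_last k, hx⟩, h.notMem (Fin.zero_le _) hx⟩

lemma sdiff_eq (h : IsChainBy P c) (i : Fin n) :
    (P i.succ).cells \ (P i.castSucc).cells = c i := by
  rw [h.union, Finset.union_sdiff_cancel_left (h.disjoint i)]

lemma eq_of_zero_eq (h : IsChainBy P c) (h' : IsChainBy P' c) (h0 : P 0 = P' 0) : P = P' := by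
  funext i
  refine YoungDiagram.ext (Finset.ext fun x => ?_)
  rw [h.mem_iff, h'.mem_iff, h0]

end IsChainBy

lemma monotone_of_strictMono_lex {n : ℕ} {e : Fin n → ℕ} {f : Fin n → ℤ}
    (h : StrictMono fun i => toLex (e i, f i)) : Monotone e :=
  fun _ _ hij => Prod.Lex.monotone_fst _ _ (h.monotone hij)

/-- A weakly increasing sequence is the sorted list of its values; this is how a weight determines
the entries along a standardisation. -/
lemma eq_of_monotone_of_card {n : ℕ} {e e' : Fin n → ℕ} (he : Monotone e) (he' : Monotone e')
    (h : ∀ k, (Finset.univ.filter fun i => e i = k).card =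
      (Finset.univ.filter fun i => e' i = k).card) : e = e' := by
  have h1 : (Finset.univ.val.map e) = Finset.univ.val.map e' := by
    ext k
    rw [Multiset.count_map, Multiset.count_map]
    have := h k
    simp only [Finset.card, Finset.filter_val] at this
    simpa only [eq_comm] using this
  rw [Fin.univ_val_map, Fin.univ_val_map, Multiset.coe_eq_coe] at h1
  exact List.ofFn_injective (h1.eq_of_sortedLE (List.sortedLE_ofFn_iff.2 he)
    (List.sortedLE_ofFn_iff.2 he'))

/-! ### Semistandard tableaux as compatible sequences of entries -/

namespace StandardTableau

variable {n : ℕ} (S : StandardTableau n)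

lemma isChainBy : IsChainBy S.part (fun i => {S.square i}) where
  disjoint i := Finset.disjoint_singleton_right.2 (S.adds_square i).1
  union i := by rw [(S.adds_square i).2, Finset.insert_eq, Finset.union_comm]

lemma square_injective : Function.Injective S.square := fun _ _ h =>
  S.isChainBy.index_eq (Finset.mem_singleton_self _) (Finset.mem_singleton.2 h)

lemma mem_skew_iff (x : ℕ × ℕ) :
    x ∈ (S.part (Fin.last n)).cells \ (S.part 0).cells ↔ ∃ k, x = S.square k := by
  rw [S.isChainBy.mem_skew_iff]
  simp

lemma skew_eq : (S.part (Fin.last n)).cells \ (S.part 0).cells = Finset.univ.image S.square := by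
  ext x
  rw [S.mem_skew_iff]
  simp [eq_comm]

/-- The sequence `e` of entries is compatible with `S`: it increases weakly along `S`, and
squares with equal entries are added by increasing position. -/
def Compatible (e : Fin n → ℕ) : Prop := StrictMono fun i => toLex (e i, pos (S.square i))

variable {S}

/-- The semistandard tableau with standardisation `S` and entries `e`. -/
noncomputable def toSemistandard {e : Fin n → ℕ} (he : S.Compatible e) :
    SemistandardTableau where
  inner := S.part 0
  outer := S.part (Fin.last n)
  le := S.isChainBy.subset (Fin.zero_le _)
  entry := Function.extend S.square e 0
  row_weak i j j' hj hx hy := by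
    rw [S.mem_skew_iff] at hx hy
    obtain ⟨k, hk⟩ := hx
    obtain ⟨l, hl⟩ := hy
    rw [hk, hl, S.square_injective.extend_apply, S.square_injective.extend_apply]
    refine monotone_of_strictMono_lex he (S.isChainBy.index_le (Finset.mem_singleton.2 hk)
      (Finset.mem_singleton.2 hl) ?_)
    exact ⟨le_rfl, hj.le⟩
  col_strict i i' j hi hx hy := by
    rw [S.mem_skew_iff] at hx hy
    obtain ⟨k, hk⟩ := hx
    obtain ⟨l, hl⟩ := hy
    have hkl : k ≤ l := S.isChainBy.index_le (Finset.mem_singleton.2 hk)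
      (Finset.mem_singleton.2 hl) ⟨hi.le, le_rfl⟩
    have hne : k ≠ l := by
      rintro rfl
      have := hk.trans hl.symm
      simp at this
      omega
    have := he (lt_of_le_of_ne hkl hne)
    rw [Prod.Lex.toLex_lt_toLex, ← hk, ← hl] at this
    rw [hk, hl, S.square_injective.extend_apply, S.square_injective.extend_apply]
    -- Equal entries would need increasing positions, but positions decrease down a column.
    refine this.resolve_right fun h => ?_
    have := h.2
    simp [pos] at this
    omega
  zeros s hs := by
    rw [S.mem_skew_iff] at hs
    rw [Function.extend_apply' _ _ _ (fun ⟨k, hk⟩ => hs ⟨k, hk.symm⟩)]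
    rfl

lemma toSemistandard_entry {e : Fin n → ℕ} (he : S.Compatible e) (i : Fin n) :
    (toSemistandard he).entry (S.square i) = e i :=
  S.square_injective.extend_apply _ _ _

lemma sdiff_eq (i : Fin n) :
    (S.part i.succ).cells \ (S.part i.castSucc).cells = {S.square i} :=
  S.isChainBy.sdiff_eq i

lemma toSemistandard_isStandardisation {e : Fin n → ℕ} (he : S.Compatible e) :
    (toSemistandard he).IsStandardisation S := by
  refine ⟨rfl, rfl, fun i j hij s hs t ht => ?_⟩
  rw [sdiff_eq, Finset.mem_singleton] at hs ht
  rw [hs, ht, toSemistandard_entry, toSemistandard_entry]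
  exact Prod.Lex.toLex_lt_toLex.1 (he hij)

end StandardTableau

namespace SemistandardTableau.IsStandardisation

variable {n n' : ℕ} {U U' : SemistandardTableau} {S S' : StandardTableau n}

lemma compatible (h : U.IsStandardisation S) : S.Compatible fun i => U.entry (S.square i) := by
  intro i j hij
  refine Prod.Lex.toLex_lt_toLex.2 (h.2.2 i j hij _ ?_ _ ?_) <;>
    rw [StandardTableau.sdiff_eq] <;> exact Finset.mem_singleton_self _

lemma skew_eq (h : U.IsStandardisation S) :
    U.outer.cells \ U.inner.cells = Finset.univ.image S.square := by
  rw [← h.1, ← h.2.1, S.skew_eq]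

lemma wt_eq (h : U.IsStandardisation S) (k : ℕ) :
    U.wt k = (Finset.univ.filter fun i => U.entry (S.square i) = k).card := by
  rw [wt, h.skew_eq, Finset.filter_image, Finset.card_image_of_injective _ S.square_injective]

lemma ext_entry (h : U.IsStandardisation S) (h' : U'.IsStandardisation S)
    (he : ∀ i, U.entry (S.square i) = U'.entry (S.square i)) : U = U' := by
  have hi : U.inner = U'.inner := h.1.symm.trans h'.1
  have ho : U.outer = U'.outer := h.2.1.symm.trans h'.2.1
  refine SemistandardTableau.ext hi ho (funext fun x => ?_)
  by_cases hx : x ∈ U.outer.cells \ U.inner.cells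
  · rw [← h.1, ← h.2.1, S.mem_skew_iff] at hx
    obtain ⟨k, rfl⟩ := hx
    exact he k
  · rw [U.zeros x hx, U'.zeros x (by rwa [← hi, ← ho])]

lemma ext_wt (h : U.IsStandardisation S) (h' : U'.IsStandardisation S) (hw : U.wt = U'.wt) :
    U = U' := by
  refine h.ext_entry h' (congrFun (eq_of_monotone_of_card
    (monotone_of_strictMono_lex h.compatible) (monotone_of_strictMono_lex h'.compatible)
    fun k => ?_))
  rw [← h.wt_eq, ← h'.wt_eq, hw]

lemma length_eq {S' : StandardTableau n'} (h : U.IsStandardisation S)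
    (h' : U.IsStandardisation S') : n = n' := by
  have := h.skew_eq.symm.trans h'.skew_eq
  apply_fun Finset.card at this
  rwa [Finset.card_image_of_injective _ S.square_injective,
    Finset.card_image_of_injective _ S'.square_injective, Finset.card_fin, Finset.card_fin] at this

/-- Both chains list the same squares by strictly increasing pairs of entry and position, and such a
list is determined by its range. -/
lemma unique (h : U.IsStandardisation S) (h' : U.IsStandardisation S') : S = S' := by
  have hr : Set.range S.square = Set.range S'.square := by
    have := congrArg (fun s : Finset (ℕ × ℕ) => (s : Set (ℕ × ℕ))) (h.skew_eq.symm.trans h'.skew_eq)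
    simpa using this
  have hk := (h.compatible.range_inj h'.compatible).1 (by
    have := congrArg (Set.image fun s => toLex (U.entry s, pos s)) hr
    rwa [← Set.range_comp, ← Set.range_comp] at this)
  have hs : S.square = S'.square := by
    funext i
    obtain ⟨j, hj⟩ : S.square i ∈ Set.range S'.square := hr ▸ Set.mem_range_self i
    have h1 := congrFun hk i
    simp only [← hj] at h1
    rw [← hj, h'.compatible.injective h1]
  refine StandardTableau.ext (S.isChainBy.eq_of_zero_eq ?_ (h.1.trans h'.1.symm))
  rw [hs]
  exact S'.isChainBy

end SemistandardTableau.IsStandardisation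

/-! ### Positions of dominoes -/

namespace Domino

lemma mem_cells {d : Domino} {x : ℕ × ℕ} : x ∈ d.cells ↔ x = (d.row, d.col) ∨ x = d.outward := by
  simp [cells]

lemma cells_nonempty (d : Domino) : d.cells.Nonempty := ⟨_, mem_cells.2 (Or.inl rfl)⟩

lemma cells_injective : Function.Injective cells := by
  intro d d' h
  have h1 := mem_cells.1 (h ▸ mem_cells.2 (Or.inl rfl) : (d.row, d.col) ∈ d'.cells)
  have h2 := mem_cells.1 (h ▸ mem_cells.2 (Or.inr rfl) : d.outward ∈ d'.cells)
  obtain ⟨i, j, _ | _⟩ := d <;> obtain ⟨k, l, _ | _⟩ := d' <;>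
    simp [outward] at * <;> omega

lemma pos_le_of_mem {d : Domino} {x : ℕ × ℕ} (h : x ∈ d.cells) :
    DominoSwitching.pos x ≤ d.pos ∧ d.pos ≤ DominoSwitching.pos x + 1 := by
  rw [mem_cells] at h
  obtain ⟨i, j, _ | _⟩ := d <;> rcases h with rfl | rfl <;>
    simp [outward, pos, DominoSwitching.pos] <;> omega

/-- The top-right square of a domino. -/
def topRight (d : Domino) : ℕ × ℕ := if d.vertical then (d.row, d.col) else d.outward

lemma topRight_mem (d : Domino) : d.topRight ∈ d.cells := by
  unfold topRight
  split_ifs <;> simp [mem_cells]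

lemma pos_topRight (d : Domino) : DominoSwitching.pos d.topRight = d.pos := by
  unfold topRight pos
  split_ifs <;> rfl

lemma not_mem_of_lt_topRight {d : Domino} {i j : ℕ} (h : i < d.topRight.1)
    (hj : j = d.topRight.2) : (i, j) ∉ d.cells := by
  rw [mem_cells]
  obtain ⟨k, l, _ | _⟩ := d <;> simp [topRight, outward] at * <;> omega

/-- Going down a column lowers the diagonal by at least one, while the position of a domino exceeds
that of its squares by at most one. -/
lemma pos_le_of_column {d d' : Domino} {i i' j : ℕ} (h : (i, j) ∈ d.cells)
    (h' : (i', j) ∈ d'.cells) (hi : i < i') : d'.pos ≤ d.pos := by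
  have h1 := (pos_le_of_mem h).1
  have h2 := (pos_le_of_mem h').2
  simp only [DominoSwitching.pos] at h1 h2
  omega

end Domino

/-! ### Semistandard domino tableaux as compatible sequences of entries -/

namespace StandardDominoTableau

variable {n : ℕ} (D : StandardDominoTableau n)

lemma isChainBy : IsChainBy D.part (fun i => (D.tile i).cells) where
  disjoint := D.disjoint_tile
  union := D.cells_succ

lemma tile_injective : Function.Injective D.tile := by
  intro i j h
  obtain ⟨x, hx⟩ := (D.tile i).cells_nonempty
  exact D.isChainBy.index_eq hx (by rwa [h] at hx)

/-- The sequence `e` of entries is compatible with `D`: it increases weakly along `D`, and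
dominoes with equal entries are added by increasing position. -/
def Compatible (e : Fin n → ℕ) : Prop := StrictMono fun i => toLex (e i, (D.tile i).pos)

variable {D}

/-- The semistandard domino tableau with standardisation `D` and entries `e`. -/
noncomputable def toSemistandard {e : Fin n → ℕ} (he : D.Compatible e) :
    SemistandardDominoTableau where
  inner := D.part 0
  outer := D.part (Fin.last n)
  le := D.isChainBy.subset (Fin.zero_le _)
  tiles := Finset.univ.image D.tile
  disjoint d hd d' hd' hne := by
    simp only [Finset.mem_image, Finset.mem_univ, true_and] at hd hd'
    obtain ⟨k, rfl⟩ := hd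
    obtain ⟨l, rfl⟩ := hd'
    exact Finset.disjoint_left.2 fun x hx hx' => hne (congrArg _ (D.isChainBy.index_eq hx hx'))
  cover := by
    ext x
    rw [D.isChainBy.mem_skew_iff]
    simp
  entry := Function.extend D.tile e 0
  row_weak d hd d' hd' i j j' hj hx hy := by
    simp only [Finset.mem_image, Finset.mem_univ, true_and] at hd hd'
    obtain ⟨k, rfl⟩ := hd
    obtain ⟨l, rfl⟩ := hd'
    rw [D.tile_injective.extend_apply, D.tile_injective.extend_apply]
    exact monotone_of_strictMono_lex he (D.isChainBy.index_le hx hy ⟨le_rfl, hj.le⟩)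
  col_strict d hd d' hd' hne i i' j hi hx hy := by
    simp only [Finset.mem_image, Finset.mem_univ, true_and] at hd hd'
    obtain ⟨k, rfl⟩ := hd
    obtain ⟨l, rfl⟩ := hd'
    have hkl : k ≤ l := D.isChainBy.index_le hx hy ⟨hi.le, le_rfl⟩
    have := he (lt_of_le_of_ne hkl fun h => hne (congrArg _ h))
    rw [Prod.Lex.toLex_lt_toLex] at this
    rw [D.tile_injective.extend_apply, D.tile_injective.extend_apply]
    exact this.resolve_right fun h => (Domino.pos_le_of_column hx hy hi).not_gt h.2
  zeros d hd := by
    rw [Function.extend_apply' _ _ _ fun ⟨k, hk⟩ => hd (Finset.mem_image.2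
      ⟨k, Finset.mem_univ _, hk⟩)]
    rfl

lemma toSemistandard_entry {e : Fin n → ℕ} (he : D.Compatible e) (i : Fin n) :
    (toSemistandard he).entry (D.tile i) = e i :=
  D.tile_injective.extend_apply _ _ _

lemma toSemistandard_isStandardisation {e : Fin n → ℕ} (he : D.Compatible e) :
    (toSemistandard he).IsStandardisation D := by
  refine ⟨rfl, rfl, D.tile, fun i => ⟨Finset.mem_image_of_mem _ (Finset.mem_univ _),
    D.sdiff_eq i⟩, fun i j hij => ?_⟩
  rw [toSemistandard_entry, toSemistandard_entry]
  exact Prod.Lex.toLex_lt_toLex.1 (he hij)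

end StandardDominoTableau

namespace SemistandardDominoTableau

namespace IsStandardisation

variable {n n' : ℕ} {D D' : SemistandardDominoTableau} {S S' : StandardDominoTableau n}

lemma tile_mem_and_compatible (h : D.IsStandardisation S) :
    (∀ i, S.tile i ∈ D.tiles) ∧ S.Compatible fun i => D.entry (S.tile i) := by
  obtain ⟨-, -, tile, h1, h2⟩ := h
  have : tile = S.tile := funext fun i =>
    Domino.cells_injective ((h1 i).2.symm.trans (S.sdiff_eq i))
  subst this
  exact ⟨fun i => (h1 i).1, fun i j hij => Prod.Lex.toLex_lt_toLex.2 (h2 i j hij)⟩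

lemma compatible (h : D.IsStandardisation S) : S.Compatible fun i => D.entry (S.tile i) :=
  h.tile_mem_and_compatible.2

lemma tiles_eq (h : D.IsStandardisation S) : D.tiles = Finset.univ.image S.tile := by
  ext d
  constructor
  · intro hd
    obtain ⟨x, hx⟩ := d.cells_nonempty
    have hx' : x ∈ D.outer.cells \ D.inner.cells := by
      rw [← D.cover]
      exact Finset.mem_biUnion.2 ⟨d, hd, hx⟩
    rw [← h.1, ← h.2.1, S.isChainBy.mem_skew_iff] at hx'
    obtain ⟨k, hk⟩ := hx'
    refine Finset.mem_image.2 ⟨k, Finset.mem_univ _, ?_⟩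
    by_contra hne
    exact Finset.disjoint_left.1 (D.disjoint _ (h.tile_mem_and_compatible.1 k) _ hd hne) hk hx
  · rintro hd
    obtain ⟨k, -, rfl⟩ := Finset.mem_image.1 hd
    exact h.tile_mem_and_compatible.1 k

lemma wt_eq (h : D.IsStandardisation S) (k : ℕ) :
    D.wt k = (Finset.univ.filter fun i => D.entry (S.tile i) = k).card := by
  rw [wt, h.tiles_eq, Finset.filter_image, Finset.card_image_of_injective _ S.tile_injective]

lemma ext_wt (h : D.IsStandardisation S) (h' : D'.IsStandardisation S) (hw : D.wt = D'.wt) :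
    D = D' := by
  have he := congrFun (eq_of_monotone_of_card
    (monotone_of_strictMono_lex h.compatible) (monotone_of_strictMono_lex h'.compatible)
    fun k => by rw [← h.wt_eq, ← h'.wt_eq, hw])
  have ht : D.tiles = D'.tiles := h.tiles_eq.trans h'.tiles_eq.symm
  refine SemistandardDominoTableau.ext (h.1.symm.trans h'.1) (h.2.1.symm.trans h'.2.1) ht
    (funext fun d => ?_)
  by_cases hd : d ∈ D.tiles
  · rw [h.tiles_eq] at hd
    obtain ⟨k, -, rfl⟩ := Finset.mem_image.1 hd
    exact he k
  · rw [D.zeros d hd, D'.zeros d (by rwa [← ht])]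

lemma length_eq {S' : StandardDominoTableau n'} (h : D.IsStandardisation S)
    (h' : D.IsStandardisation S') : n = n' := by
  have := h.tiles_eq.symm.trans h'.tiles_eq
  apply_fun Finset.card at this
  rwa [Finset.card_image_of_injective _ S.tile_injective,
    Finset.card_image_of_injective _ S'.tile_injective, Finset.card_fin, Finset.card_fin] at this

lemma unique (h : D.IsStandardisation S) (h' : D.IsStandardisation S') : S = S' := by
  have hr : Set.range S.tile = Set.range S'.tile := by
    have := congrArg (fun s : Finset Domino => (s : Set Domino)) (h.tiles_eq.symm.trans h'.tiles_eq)
    simpa using this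
  have hk := (h.compatible.range_inj h'.compatible).1 (by
    have := congrArg (Set.image fun s => toLex (D.entry s, s.pos)) hr
    rwa [← Set.range_comp, ← Set.range_comp] at this)
  have hs : S.tile = S'.tile := by
    funext i
    obtain ⟨j, hj⟩ : S.tile i ∈ Set.range S'.tile := hr ▸ Set.mem_range_self i
    have h1 := congrFun hk i
    simp only [← hj] at h1
    rw [← hj, h'.compatible.injective h1]
  refine StandardDominoTableau.ext (S.isChainBy.eq_of_zero_eq ?_ (h.1.trans h'.1.symm))
  rw [hs]
  exact S'.isChainBy

end IsStandardisation

/-! ### Existence of the standardisation of a domino tableau -/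

variable (D : SemistandardDominoTableau)

/-- The key by which the dominoes are sorted in the standardisation. -/
def key (d : Domino) : ℕ ×ₗ ℤ := toLex (D.entry d, d.pos)

variable {D}

lemma mem_skew_of_mem {d : Domino} (hd : d ∈ D.tiles) {x : ℕ × ℕ} (hx : x ∈ d.cells) :
    x ∈ D.outer.cells ∧ x ∉ D.inner.cells := by
  rw [← Finset.mem_sdiff, ← D.cover]
  exact Finset.mem_biUnion.2 ⟨d, hd, hx⟩

lemma exists_tile {x : ℕ × ℕ} (hx : x ∈ D.outer.cells) (hx' : x ∉ D.inner.cells) :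
    ∃ d ∈ D.tiles, x ∈ d.cells := by
  have := Finset.mem_sdiff.2 ⟨hx, hx'⟩
  rwa [← D.cover, Finset.mem_biUnion] at this

lemma exists_tile_between {d d' : Domino} (hd : d ∈ D.tiles) (hd' : d' ∈ D.tiles)
    {x y z : ℕ × ℕ} (hx : x ∈ d.cells) (hz : z ∈ d'.cells) (hxy : x ≤ y) (hyz : y ≤ z) :
    ∃ d ∈ D.tiles, y ∈ d.cells :=
  exists_tile (lowerCells _ hyz (mem_skew_of_mem hd' hz).1)
    fun hm => (mem_skew_of_mem hd hx).2 (lowerCells _ hxy hm)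

lemma eq_of_mem {d d' : Domino} (hd : d ∈ D.tiles) (hd' : d' ∈ D.tiles) {x : ℕ × ℕ}
    (hx : x ∈ d.cells) (hx' : x ∈ d'.cells) : d = d' := by
  by_contra hne
  exact Finset.disjoint_left.1 (D.disjoint d hd d' hd' hne) hx hx'

lemma entry_le_of_row {d d' : Domino} (hd : d ∈ D.tiles) (hd' : d' ∈ D.tiles) {i j j' : ℕ}
    (hx : (i, j) ∈ d.cells) (hy : (i, j') ∈ d'.cells) (hj : j ≤ j') : D.entry d ≤ D.entry d' := by
  rcases hj.eq_or_lt with rfl | hj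
  · rw [eq_of_mem hd hd' hx hy]
  · exact D.row_weak d hd d' hd' i j j' hj hx hy

/-- If two tiles have equal positions, their top-right squares lie on one diagonal. The tile at the
corner in the row of the upper one and the column of the lower one has entry at least that of the
upper tile, and strictly less than that of the lower tile, which has no square above its top-right
square. -/
lemma key_injOn : Set.InjOn D.key D.tiles := by
  intro d hd d' hd' h
  have h : toLex (D.entry d, d.pos) = toLex (D.entry d', d'.pos) := h
  simp only [toLex_inj, Prod.mk.injEq] at h
  by_contra hne
  have hxy : d.topRight ≠ d'.topRight := fun e =>
    hne (eq_of_mem hd hd' d.topRight_mem (e ▸ d'.topRight_mem))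
  have hp : pos d.topRight = pos d'.topRight := by
    rw [d.pos_topRight, d'.pos_topRight, h.2]
  have aux : ∀ d ∈ D.tiles, ∀ d' ∈ D.tiles, d.topRight ≤ d'.topRight →
      d.topRight ≠ d'.topRight → pos d.topRight = pos d'.topRight →
      D.entry d < D.entry d' := by
    intro d hd d' hd' hle hne hp
    have h1 := d.topRight_mem
    have h2 := d'.topRight_mem
    have hlt : d.topRight.1 < d'.topRight.1 := by
      refine lt_of_le_of_ne hle.1 fun e => hne (Prod.ext e ?_)
      simp only [pos] at hp
      omega
    have h3 := Domino.not_mem_of_lt_topRight hlt rfl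
    obtain ⟨c, hc, hy⟩ := exists_tile_between hd hd' (y := (d.topRight.1, d'.topRight.2)) h1 h2
      ⟨le_rfl, hle.2⟩ ⟨hle.1, le_rfl⟩
    refine (entry_le_of_row hd hc h1 hy hle.2).trans_lt ?_
    exact D.col_strict c hc d' hd' (fun e => h3 (e ▸ hy)) _ _ _ hlt hy h2
  rcases Adds.le_or_le_of_pos_eq hp with hl | hl
  · exact (aux d hd d' hd' hl hxy hp).ne h.1
  · exact (aux d' hd' d hd hl hxy.symm hp.symm).ne' h.1

/-- The route goes along the row of `x` to the column of `y`, then down. If the tile `c` at the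
corner differs from `d'`, the descent makes the entry strictly larger; otherwise `d'` meets the row
of `x` at or to the right of `x`, and its position cannot be smaller. -/
lemma key_le_of_le {d d' : Domino} (hd : d ∈ D.tiles) (hd' : d' ∈ D.tiles) {x y : ℕ × ℕ}
    (hx : x ∈ d.cells) (hy : y ∈ d'.cells) (hxy : x ≤ y) : D.key d ≤ D.key d' := by
  obtain ⟨i, j⟩ := x
  obtain ⟨k, l⟩ := y
  obtain ⟨c, hc, hz⟩ := exists_tile_between hd hd' (y := (i, l)) hx hy
    ⟨le_rfl, hxy.2⟩ ⟨hxy.1, le_rfl⟩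
  have h1 := entry_le_of_row hd hc hx hz hxy.2
  change toLex _ ≤ toLex _
  rw [Prod.Lex.toLex_le_toLex]
  by_cases hcd : c = d'
  · subst hcd
    rcases hxy.2.eq_or_lt with e | hlt
    · have : d = c := eq_of_mem hd hc hx (by rw [show j = l from e]; exact hz)
      rw [this]
      exact Or.inr ⟨rfl, le_rfl⟩
    · rcases h1.lt_or_eq with h | h
      · exact Or.inl h
      · refine Or.inr ⟨h, ?_⟩
        have h2 := (Domino.pos_le_of_mem hx).2
        have h3 := (Domino.pos_le_of_mem hz).1
        simp only [pos] at h2 h3 hlt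
        omega
  · left
    have hik : i < k := by
      refine lt_of_le_of_ne hxy.1 fun e => hcd (eq_of_mem hc hd' hz ?_)
      rw [show i = k from e]
      exact hy
    exact h1.trans_lt (D.col_strict c hc d' hd' hcd i k l hik hz hy)

/-- The tiles are sorted by key. By `key_le_of_le`, an initial segment of them together with the
inner partition is again a Young diagram. -/
theorem exists_isStandardisation (D : SemistandardDominoTableau) :
    ∃ (n : ℕ) (S : StandardDominoTableau n), D.IsStandardisation S := by
  classical
  let K := D.tiles.image D.key
  let f := K.orderEmbOfFin rfl
  have hf : ∀ i, ∃ d ∈ D.tiles, D.key d = f i := fun i =>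
    Finset.mem_image.1 (K.orderEmbOfFin_mem rfl i)
  choose tile htile hkey using hf
  have hsurj : ∀ d ∈ D.tiles, ∃ i, tile i = d := by
    intro d hd
    have : D.key d ∈ Set.range f := by
      rw [Finset.range_orderEmbOfFin]
      exact Finset.mem_image_of_mem _ hd
    obtain ⟨i, hi⟩ := this
    exact ⟨i, key_injOn (htile i) hd ((hkey i).trans hi)⟩
  have hinj : Function.Injective tile := by
    intro i j h
    apply f.injective
    rw [← hkey, ← hkey, h]
  let cells : ℕ → Finset (ℕ × ℕ) := fun m =>
    D.inner.cells ∪ (Finset.univ.filter fun i : Fin K.card => (i : ℕ) < m).biUnion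
      fun i : Fin K.card => (tile i).cells
  have hmem : ∀ m x, x ∈ cells m ↔
      x ∈ D.inner.cells ∨ ∃ i : Fin K.card, (i : ℕ) < m ∧ x ∈ (tile i).cells := by
    intro m x
    simp only [cells, Finset.mem_union, Finset.mem_biUnion, Finset.mem_filter, Finset.mem_univ,
      true_and]
  have hlow : ∀ m, IsLowerSet (cells m : Set (ℕ × ℕ)) := by
    intro m y x hxy hy
    rw [Finset.mem_coe, hmem] at hy ⊢
    rcases hy with hy | ⟨i, hi, hy⟩
    · exact Or.inl (lowerCells _ hxy hy)
    · by_cases hx : x ∈ D.inner.cells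
      · exact Or.inl hx
      · right
        obtain ⟨d, hd, hxd⟩ := exists_tile
          (lowerCells _ hxy (mem_skew_of_mem (htile i) hy).1) hx
        obtain ⟨j, rfl⟩ := hsurj d hd
        have := key_le_of_le hd (htile i) hxd hy hxy
        rw [hkey, hkey, f.le_iff_le] at this
        exact ⟨j, lt_of_le_of_lt this hi, hxd⟩
  have hdisj : ∀ i : Fin K.card, Disjoint (cells i) (tile i).cells := by
    intro i
    rw [Finset.disjoint_right]
    intro x hx hm
    rw [hmem] at hm
    rcases hm with hm | ⟨j, hj, hm⟩
    · exact (mem_skew_of_mem (htile i) hx).2 hm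
    · have := hinj (eq_of_mem (htile i) (htile j) hx hm)
      subst this
      exact lt_irrefl _ hj
  have hunion : ∀ i : Fin K.card, cells (i + 1) = cells i ∪ (tile i).cells := by
    intro i
    ext x
    rw [hmem, Finset.mem_union (s := cells i), hmem, or_assoc]
    refine or_congr_right ?_
    constructor
    · rintro ⟨j, hj, hx⟩
      rcases (Nat.lt_succ_iff.1 hj).eq_or_lt with e | hlt
      · exact Or.inr (Fin.ext e ▸ hx)
      · exact Or.inl ⟨j, hlt, hx⟩
    · rintro (⟨j, hj, hx⟩ | hx)
      · exact ⟨j, by omega, hx⟩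
      · exact ⟨i, by omega, hx⟩
  let S : StandardDominoTableau K.card :=
    ⟨fun i => ⟨cells i, hlow i⟩, fun i => ⟨tile i, hdisj i, hunion i⟩⟩
  refine ⟨K.card, S, ?_, ?_, tile, fun i => ⟨htile i, ?_⟩, fun i j hij => ?_⟩
  · refine YoungDiagram.ext (Finset.ext fun x => ?_)
    change x ∈ cells 0 ↔ _
    simp [hmem]
  · refine YoungDiagram.ext (Finset.ext fun x => ?_)
    change x ∈ cells K.card ↔ _
    rw [hmem]
    constructor
    · rintro (hx | ⟨i, -, hx⟩)
      · exact D.le hx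
      · exact (mem_skew_of_mem (htile i) hx).1
    · intro hx
      by_cases hx' : x ∈ D.inner.cells
      · exact Or.inl hx'
      · obtain ⟨d, hd, hxd⟩ := exists_tile hx hx'
        obtain ⟨i, rfl⟩ := hsurj d hd
        exact Or.inr ⟨i, i.2, hxd⟩
  · change cells (i + 1) \ cells i = _
    rw [hunion, Finset.union_sdiff_cancel_left (hdisj i)]
  · have := f.strictMono hij
    rw [← hkey, ← hkey] at this
    exact Prod.Lex.toLex_lt_toLex.1 this

end SemistandardDominoTableau

lemma StandardTableau.toSemistandard_wt {n : ℕ} {S : StandardTableau n} {e : Fin n → ℕ}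
    (he : S.Compatible e) (k : ℕ) :
    (toSemistandard he).wt k = (Finset.univ.filter fun i => e i = k).card := by
  rw [(toSemistandard_isStandardisation he).wt_eq]
  simp only [toSemistandard_entry]

lemma StandardDominoTableau.toSemistandard_wt {n : ℕ} {D : StandardDominoTableau n}
    {e : Fin n → ℕ} (he : D.Compatible e) (k : ℕ) :
    (toSemistandard he).wt k = (Finset.univ.filter fun i => e i = k).card := by
  rw [(toSemistandard_isStandardisation he).wt_eq]
  simp only [toSemistandard_entry]

/-! ### Transfer of entries and the bijection -/

namespace SwitchingFamily

variable {n : ℕ} {F : SwitchingFamily n n} {D : StandardDominoTableau n}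

lemma compatible_left_iff (hF : ∀ i j, F.part i j = F.part j i)
    (hD : ∀ i, F.part i i = D.part i) (e : Fin n → ℕ) :
    D.Compatible e ↔ F.left.Compatible e := by
  rw [← top_eq_left hF]
  exact (sameAscents_diagonal hD 0).strictMono_iff e

lemma compatible_bottom_iff (hD : ∀ i, F.part i i = D.part i) (e : Fin n → ℕ) :
    D.Compatible e ↔ F.bottom.Compatible e :=
  (sameAscents_diagonal hD (Fin.last n)).strictMono_iff e

end SwitchingFamily

namespace SemistandardDominoTableau

variable {D D' : SemistandardDominoTableau} {U V U' V' : SemistandardTableau}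

/-- The entry sequence of the domino tableau is compatible with both edges of the symmetric family,
and reusing it keeps the weight. -/
lemma exists_isPi1 (D : SemistandardDominoTableau) : ∃ U V, D.IsPi1 U V := by
  obtain ⟨n, D₀, hD₀⟩ := D.exists_isStandardisation
  obtain ⟨F, hF, hd⟩ := SwitchingFamily.exists_symmetric D₀
  have hS := (SwitchingFamily.compatible_left_iff hF hd _).1 hD₀.compatible
  have hT := (SwitchingFamily.compatible_bottom_iff hd _).1 hD₀.compatible
  refine ⟨StandardTableau.toSemistandard hS, StandardTableau.toSemistandard hT,
    funext fun k => ?_, funext fun k => ?_, n, D₀, F.left, F.bottom, hD₀,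
    StandardTableau.toSemistandard_isStandardisation hS,
    StandardTableau.toSemistandard_isStandardisation hT, F, hF, hd, rfl, rfl⟩
  · rw [StandardTableau.toSemistandard_wt, hD₀.wt_eq]
  · rw [StandardTableau.toSemistandard_wt, hD₀.wt_eq]

namespace IsPi1

lemma join (h : D.IsPi1 U V) : U.outer = V.inner := by
  obtain ⟨-, -, n, D₀, S, T, -, hU, hV, F, -, -, rfl, rfl⟩ := h
  exact hU.2.1.symm.trans hV.1

lemma selfSwitching (h : D.IsPi1 U V) : SemistandardTableau.Switch U V U V := by
  obtain ⟨hwU, hwV, n, D₀, S, T, -, hU, hV, F, hF, -, rfl, rfl⟩ := h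
  exact ⟨hwU.trans hwV.symm, hwV.trans hwU.symm, n, n, F.left, F.bottom, F.left, F.bottom,
    hU, hV, hU, hV, F, rfl, rfl, SwitchingFamily.top_eq_left hF,
    SwitchingFamily.right_eq_bottom hF⟩

lemma inner_eq (h : D.IsPi1 U V) : U.inner = D.inner := by
  obtain ⟨-, -, n, D₀, S, T, hD, hU, -, F, -, hd, rfl, rfl⟩ := h
  exact hU.1.symm.trans ((hd 0).trans hD.1)

lemma outer_eq (h : D.IsPi1 U V) : V.outer = D.outer := by
  obtain ⟨-, -, n, D₀, S, T, hD, -, hV, F, -, hd, rfl, rfl⟩ := h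
  exact hV.2.1.symm.trans ((hd (Fin.last n)).trans hD.2.1)

lemma unique (h : D.IsPi1 U V) (h' : D.IsPi1 U' V') : U = U' ∧ V = V' := by
  obtain ⟨hwU, hwV, n, D₀, S, T, hD, hU, hV, F, hF, hd, rfl, rfl⟩ := h
  obtain ⟨hwU', hwV', n', D₀', S', T', hD', hU', hV', F', hF', hd', rfl, rfl⟩ := h'
  obtain rfl := hD.length_eq hD'
  obtain rfl := hD.unique hD'
  obtain rfl := SwitchingFamily.eq_of_diagonal hF hF' fun i => (hd i).trans (hd' i).symm
  exact ⟨hU.ext_wt hU' (hwU.trans hwU'.symm), hV.ext_wt hV' (hwV.trans hwV'.symm)⟩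

/-- The pair determines its standardisations, hence the whole family and its diagonal; the weight
then recovers the entries. -/
lemma injective (h : D.IsPi1 U V) (h' : D'.IsPi1 U V) : D = D' := by
  obtain ⟨hwU, -, n, D₀, S, T, hD, hU, hV, F, hF, hd, rfl, rfl⟩ := h
  obtain ⟨hwU', -, n', D₀', S', T', hD', hU', hV', F', hF', hd', hl, hb⟩ := h'
  obtain rfl := hU.length_eq hU'
  obtain rfl := hU.unique hU'
  obtain rfl := hV.unique hV'
  obtain rfl := SwitchingFamily.eq_of_left_of_bottom hl hb
  obtain rfl : D₀ = D₀' := StandardDominoTableau.ext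
    (funext fun i => (hd i).symm.trans (hd' i))
  exact hD.ext_wt hD' (hwU.symm.trans hwU')

end IsPi1

/-- Uniqueness of standardisations turns self-switching of the pair into self-switching of the
standard tableaux, so the family is symmetric; its diagonal carries the entries of `U`. -/
lemma exists_isPi1_of_switch (h : SemistandardTableau.Switch U V U V) :
    ∃ D : SemistandardDominoTableau, D.IsPi1 U V := by
  obtain ⟨hw, -, m, n, S, T, T', S', hS, hT, hT', hS', F, hl, hb, ht, hr⟩ := h
  obtain rfl := hS.length_eq hT'
  obtain rfl := hS.unique hT'
  obtain rfl := hT.unique hS'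
  have hF := SwitchingFamily.symmetric_of_self (ht.trans hl.symm) (hr.trans hb.symm)
  let D₀ : StandardDominoTableau m :=
    ⟨fun i => F.part i i, SwitchingFamily.addsDomino_diagonal hF⟩
  have hc : D₀.Compatible fun i => U.entry (S.square i) := by
    rw [SwitchingFamily.compatible_left_iff (D := D₀) hF (fun _ => rfl), hl]
    exact hS.compatible
  have hwt : U.wt = (StandardDominoTableau.toSemistandard hc).wt := funext fun k => by
    rw [StandardDominoTableau.toSemistandard_wt, hS.wt_eq]
  exact ⟨StandardDominoTableau.toSemistandard hc, hwt, hw.symm.trans hwt, m, D₀, S, T,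
    StandardDominoTableau.toSemistandard_isStandardisation hc, hS, hT, F, hF, fun _ => rfl, hl, hb⟩

end SemistandardDominoTableau

end DominoSwitching

/-- The correspondence `π₁` is (the graph of) a map from semistandard domino tableaux to
self-switching pairs of semistandard tableaux, and this map is a bijection that preserves
shapes and weights. -/
theorem mainTheorem6 :
    ∃ π₁ : DominoSwitching.SemistandardDominoTableau → DominoSwitching.SelfSwitchingPair,
      (∀ (D : DominoSwitching.SemistandardDominoTableau)
          (U V : DominoSwitching.SemistandardTableau),
        D.IsPi1 U V ↔ (π₁ D).fst = U ∧ (π₁ D).snd = V) ∧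
      Function.Bijective π₁ ∧
      (∀ D : DominoSwitching.SemistandardDominoTableau,
        (π₁ D).fst.inner = D.inner ∧ (π₁ D).snd.outer = D.outer) ∧
      (∀ D : DominoSwitching.SemistandardDominoTableau,
        (π₁ D).fst.wt = D.wt ∧ (π₁ D).snd.wt = D.wt) := by
  choose U V h using DominoSwitching.SemistandardDominoTableau.exists_isPi1
  refine ⟨fun D => ⟨U D, V D, (h D).join, (h D).selfSwitching⟩, fun D U' V' => ⟨fun h' =>
    (h D).unique h', ?_⟩, ⟨fun D D' hDD' => ?_, fun P => ?_⟩,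
    fun D => ⟨(h D).inner_eq, (h D).outer_eq⟩, fun D => ⟨(h D).1, (h D).2.1⟩⟩
  · rintro ⟨rfl, rfl⟩
    exact h D
  · simp only [DominoSwitching.SelfSwitchingPair.mk.injEq] at hDD'
    have h' := h D'
    rw [← hDD'.1, ← hDD'.2] at h'
    exact (h D).injective h'
  · obtain ⟨D, hD⟩ :=
      DominoSwitching.SemistandardDominoTableau.exists_isPi1_of_switch P.selfSwitching
    obtain ⟨h1, h2⟩ := (h D).unique hD
    exact ⟨D, DominoSwitching.SelfSwitchingPair.ext h1 h2⟩
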